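/- Consider the incidence structure with nine points $A,B,C,D,E,F,G,H,I$ and the nine lines $ABEF$, $ADG$, $AHI$, $BCH$, $BGI$, $CEG$, $CFI$, $DEI$, $DFH$. A realization of it in $\mathbb R^2$ consists of points $(x_j,y_j)$ and lines $a_iX+b_iY+c_i=0$ (with $(a_i,b_i)\neq(0,0)$), $1\le i,j\le 9$, such that the $j$-th point lies on the $i$-th line exactly when the structure says so. Given a realization, let $D$ be the $9\times 3$ matrix with rows $(a_i,b_i,c_i)$, let $C$ be the $3\times 9$ matrix with columns $(x_j,y_j,1)^T$, and put $$B=\begin{pmatrix} I_3 & C\\ D& DC\end{pmatrix},\qquad A=\begin{pmatrix}0&B\\ B^T&0\end{pmatrix}.$$ Let $G$ be the graph on the $24$ row indices of $A$ in which $p$ and $q$ are adjacent if and only if $A_{pq}\neq 0$. For a field $\mathbb F$, let $\mathrm{mr}_{\mathbb F}(G)$ be the least rank of a symmetric matrix $M$ over $\mathbb F$, indexed by the vertices of $G$, such that for all $p\ne q$, $M_{pq}\neq0$ if and only if $pq$ is an edge of $G$ (the diagonal entries are arbitrary). Let $\mathrm{mr}^0_{\mathbb F}(G)$ be the least rank of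 a matrix $M$ over $\mathbb F$, not necessarily symmetric, that has the same zero-nonzero pattern as the adjacency matrix of $G$, diagonal included (equivalently, the same pattern as $A$). Then a realization in $\mathbb R^2$ exists, and for every realization: $\operatorname{rank} B=3$; $A$ is a $24\times24$ symmetric matrix of rank $6$; $G$ is bipartite with the $12$ first and the $12$ last indices as its two sides; and $$\mathrm{mr}_{\mathbb R}(G)=6<\mathrm{mr}_{\mathbb Q}(G),\qquad \mathrm{mr}^0_{\mathbb R}(G)=6<\mathrm{mr}^0_{\mathbb Q}(G).$$ -/

import Mathlib

/-- The nine lines of the configuration, each given by the set of configuration points on it.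
The points `A, B, C, D, E, F, G, H, I` are numbered `0, 1, …, 8`, and the lines are, in order,
`ABEF, ADG, AHI, BCH, BGI, CEG, CFI, DEI, DFH`. -/
def configLine : Fin 9 → Finset (Fin 9) :=
  ![{0, 1, 4, 5}, {0, 3, 6}, {0, 7, 8}, {1, 2, 7}, {1, 6, 8},
    {2, 4, 6}, {2, 5, 8}, {3, 4, 8}, {3, 5, 7}]

/-- The points `(x j, y j)` and the lines `a i * X + b i * Y + c i = 0` of the real plane realize
the configuration: point `j` is on line `i` exactly when the configuration says so. -/
def Realizes (x y a b c : Fin 9 → ℝ) : Prop :=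
  (∀ i, a i ≠ 0 ∨ b i ≠ 0) ∧
    ∀ i j, a i * x j + b i * y j + c i = 0 ↔ j ∈ configLine i

/-- The `9 × 3` matrix with rows `(a i, b i, c i)`. -/
def lineMatrix (a b c : Fin 9 → ℝ) : Matrix (Fin 9) (Fin 3) ℝ :=
  Matrix.of fun i => ![a i, b i, c i]

/-- The `3 × 9` matrix with columns `(x j, y j, 1)`. -/
def pointMatrix (x y : Fin 9 → ℝ) : Matrix (Fin 3) (Fin 9) ℝ :=
  Matrix.of ![x, y, fun _ => 1]

/-- The `12 × 12` matrix `B = [I₃ C; D DC]`. -/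
def matB (x y a b c : Fin 9 → ℝ) : Matrix (Fin 3 ⊕ Fin 9) (Fin 3 ⊕ Fin 9) ℝ :=
  Matrix.fromBlocks 1 (pointMatrix x y) (lineMatrix a b c) (lineMatrix a b c * pointMatrix x y)

/-- The `24 × 24` matrix `A = [0 B; Bᵀ 0]`. -/
def matA (x y a b c : Fin 9 → ℝ) :
    Matrix ((Fin 3 ⊕ Fin 9) ⊕ (Fin 3 ⊕ Fin 9)) ((Fin 3 ⊕ Fin 9) ⊕ (Fin 3 ⊕ Fin 9)) ℝ :=
  Matrix.fromBlocks 0 (matB x y a b c) (matB x y a b c).transpose 0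

/-- The bipartite graph whose adjacency matrix has the zero-nonzero pattern of `A`. -/
def configGraph (x y a b c : Fin 9 → ℝ) :
    SimpleGraph ((Fin 3 ⊕ Fin 9) ⊕ (Fin 3 ⊕ Fin 9)) where
  Adj p q := matA x y a b c p q ≠ 0
  symm := ⟨by
    rintro (p | p) (q | q) h <;>
      simpa [matA, Matrix.fromBlocks, Matrix.transpose_apply] using h⟩
  loopless := ⟨by
    rintro (p | p) h <;> simp [matA, Matrix.fromBlocks] at h⟩

/-- The symmetric matrices over `F` described by the graph `G`: an off-diagonal entry is nonzero
exactly at the edges of `G`, and the diagonal is unrestricted. -/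
def graphClass (F : Type*) [Field F] {V : Type*} (G : SimpleGraph V) : Set (Matrix V V F) :=
  {M | M.IsSymm ∧ ∀ p q, p ≠ q → (M p q ≠ 0 ↔ G.Adj p q)}

/-- The minimum rank of the graph `G` over the field `F`. -/
noncomputable def graphMinRank (F : Type*) [Field F] {V : Type*} [Fintype V]
    (G : SimpleGraph V) : ℕ :=
  sInf (Matrix.rank '' graphClass F G)

/-- All matrices over `F` (symmetric or not) that have the same zero-nonzero pattern as the
adjacency matrix of `G`, the diagonal included (so the diagonal is zero). -/
def adjPatternClass (F : Type*) [Field F] {V : Type*} (G : SimpleGraph V) : Set (Matrix V V F) :=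
  {M | ∀ p q, M p q ≠ 0 ↔ G.Adj p q}

/-- The minimum rank over `F` of the zero-nonzero pattern of the adjacency matrix of `G`. -/
noncomputable def adjPatternMinRank (F : Type*) [Field F] {V : Type*} [Fintype V]
    (G : SimpleGraph V) : ℕ :=
  sInf (Matrix.rank '' adjPatternClass F G)

/-- Both classes contain the adjacency matrix, so the minima are over nonempty sets. -/
theorem adjMatrix_mem_classes (F : Type*) [Field F] {V : Type*} (G : SimpleGraph V)
    [DecidableRel G.Adj] :
    G.adjMatrix F ∈ graphClass F G ∧ G.adjMatrix F ∈ adjPatternClass F G := by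
  refine ⟨⟨G.isSymm_adjMatrix, fun p q _ => ?_⟩, fun p q => ?_⟩ <;>
    simp [SimpleGraph.adjMatrix_apply]

/-! The factorization `B = (I; D)(I C)` gives rank 3 for `B` and at most 6 for `A`. The lower bounds
use only the off-diagonal pattern on the lines and points, shared by both matrix classes. A
triangular submatrix gives rank at least 6 over every field (`HasConfigPattern.six_le_rank`). If the
rank is 6, the diagonal entries at `A`, `B`, `G` vanish, so the rows of these points and of the
three sides of the triangle `ABG` form a basis of the row space. The point rows are zero on the
point columns, so there every line row is a combination of the three sides
(`HasConfigPattern.exists_coeff`). The incidence block is thus a projective realization of the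
configuration over the field, which forces a root of `t ^ 2 + t = 1`
(`HasConfigPattern.exists_golden`). Such a root exists in ℝ but not in ℚ. -/

/-- A linear order on chosen rows and columns in which the chosen submatrix is lower triangular with
nonzero diagonal makes the chosen rows independent. -/
theorem linearIndependent_of_lowerTriangular {F m k : Type*} [Field F] {n : ℕ}
    (M : Matrix m k F) (r : Fin n → m) (c : Fin n → k) (hd : ∀ i, M (r i) (c i) ≠ 0)
    (h0 : ∀ i j, i < j → M (r i) (c j) = 0) : LinearIndependent F (fun i => M (r i)) := by
  have hdet : (M.submatrix r c).det ≠ 0 := by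
    rw [Matrix.det_of_isLowerTriangular (M.submatrix r c) fun i j hij => h0 i j hij,
      Finset.prod_ne_zero_iff]
    exact fun i _ => hd i
  exact LinearIndependent.of_comp (LinearMap.funLeft F F c)
    (Matrix.linearIndependent_rows_of_det_ne_zero hdet)

theorem le_rank_of_linearIndependent_rows {F m k : Type*} [Field F] [Finite m] [Fintype k] {n : ℕ}
    (M : Matrix m k F) (r : Fin n → m) (h : LinearIndependent F (fun i => M (r i))) :
    n ≤ M.rank := by
  have h1 := h.rank_matrix (M := M.submatrix r id)
  rw [Fintype.card_fin] at h1
  exact h1 ▸ Matrix.rank_submatrix_le M r id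

/-- Independent rows, as many as the rank, span all rows. -/
theorem exists_row_eq_sum {F m k : Type*} [Field F] [Finite m] [Fintype k] {n : ℕ}
    (M : Matrix m k F) (r : Fin n → m) (h : LinearIndependent F (fun i => M (r i)))
    (hr : M.rank ≤ n) (i : m) : ∃ α : Fin n → F, ∀ j, M i j = ∑ l, α l * M (r l) j := by
  have hle : Submodule.span F (Set.range fun i => M (r i)) ≤
      Submodule.span F (Set.range M.row) := by
    apply Submodule.span_mono
    rintro _ ⟨l, rfl⟩
    exact ⟨r l, rfl⟩
  have heq := Submodule.eq_of_le_of_finrank_le hle (by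
    rw [← Matrix.rank_eq_finrank_span_row, finrank_span_eq_card h, Fintype.card_fin]
    exact hr)
  have hmem : M i ∈ Submodule.span F (Set.range fun i => M (r i)) :=
    heq ▸ Submodule.subset_span ⟨i, rfl⟩
  obtain ⟨α, hα⟩ := (Submodule.mem_span_range_iff_exists_fun F).1 hmem
  refine ⟨α, fun j => ?_⟩
  rw [← hα]
  simp

/-! ### Matrices of rank six with the configuration pattern -/

/-- Lines (left) and points (right) of the configuration are nonadjacent when they are of the same
kind or incident. -/
def nonAdj : Fin 9 ⊕ Fin 9 → Fin 9 ⊕ Fin 9 → Bool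
  | .inl _, .inl _ => true
  | .inr _, .inr _ => true
  | .inl i, .inr j => decide (j ∈ configLine i)
  | .inr j, .inl i => decide (j ∈ configLine i)

/-- Off the diagonal, the zeros of `N` are at the nonadjacent pairs of lines and points. -/
def HasConfigPattern {F : Type*} [Field F] (N : Matrix (Fin 9 ⊕ Fin 9) (Fin 9 ⊕ Fin 9) F) : Prop :=
  ∀ p q, p ≠ q → (N p q = 0 ↔ nonAdj p q = true)

/-- The chosen rows and columns have no index in common, so the free diagonal is avoided. -/
theorem HasConfigPattern.six_le_rank {F : Type*} [Field F]
    {N : Matrix (Fin 9 ⊕ Fin 9) (Fin 9 ⊕ Fin 9) F} (hN : HasConfigPattern N) : 6 ≤ N.rank := by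
  let r : Fin 6 → Fin 9 ⊕ Fin 9 := ![.inr 3, .inr 4, .inr 2, .inl 2, .inl 3, .inl 4]
  let c : Fin 6 → Fin 9 ⊕ Fin 9 := ![.inl 0, .inl 1, .inl 7, .inr 5, .inr 8, .inr 7]
  have hd : ∀ i, r i ≠ c i ∧ ¬ nonAdj (r i) (c i) = true := by decide
  have h0 : ∀ i j, i < j → r i ≠ c j ∧ nonAdj (r i) (c j) = true := by decide
  exact le_rank_of_linearIndependent_rows N r (linearIndependent_of_lowerTriangular N r c
    (fun i => (hN _ _ (hd i).1).not.2 (hd i).2) fun i j h => (hN _ _ (h0 i j h).1).2 (h0 i j h).2)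

/-- A nonzero entry at `(v, v)` would extend the triangular submatrix of
`HasConfigPattern.six_le_rank` to size 7. -/
theorem HasConfigPattern.diag_eq_zero {F : Type*} [Field F]
    {N : Matrix (Fin 9 ⊕ Fin 9) (Fin 9 ⊕ Fin 9) F} (hN : HasConfigPattern N) (hr : N.rank ≤ 6)
    {v : Fin 9} (hv : v = 0 ∨ v = 1 ∨ v = 6) : N (.inr v) (.inr v) = 0 := by
  by_contra hne
  let r : Fin 7 → Fin 9 ⊕ Fin 9 := ![.inr 3, .inr 4, .inr 2, .inr v, .inl 2, .inl 3, .inl 4]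
  let c : Fin 7 → Fin 9 ⊕ Fin 9 := ![.inl 0, .inl 1, .inl 7, .inr v, .inr 5, .inr 8, .inr 7]
  have hd : ∀ i, i = 3 ∨ (r i ≠ c i ∧ ¬ nonAdj (r i) (c i) = true) := by
    rcases hv with rfl | rfl | rfl <;> decide
  have h0 : ∀ i j, i < j → r i ≠ c j ∧ nonAdj (r i) (c j) = true := by
    rcases hv with rfl | rfl | rfl <;> decide
  have h7 := le_rank_of_linearIndependent_rows N r (linearIndependent_of_lowerTriangular N r c
    (fun i => by
      rcases hd i with rfl | h
      · exact hne
      · exact (hN _ _ h.1).not.2 h.2)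
    fun i j h => (hN _ _ (h0 i j h).1).2 (h0 i j h).2)
  omega

/-- In rank at most six the lines `ABEF`, `ADG`, `BGI` generate the incidence block. -/
theorem HasConfigPattern.exists_coeff {F : Type*} [Field F]
    {N : Matrix (Fin 9 ⊕ Fin 9) (Fin 9 ⊕ Fin 9) F} (hN : HasConfigPattern N) (hr : N.rank ≤ 6)
    (i : Fin 9) : ∃ u v w : F, ∀ j, N (.inl i) (.inr j) =
      u * N (.inl 4) (.inr j) + v * N (.inl 1) (.inr j) + w * N (.inl 0) (.inr j) := by
  let r : Fin 6 → Fin 9 ⊕ Fin 9 := ![.inr 0, .inr 1, .inr 6, .inl 0, .inl 1, .inl 4]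
  let c : Fin 6 → Fin 9 ⊕ Fin 9 := ![.inl 4, .inl 1, .inl 0, .inr 6, .inr 1, .inr 0]
  have hpt : ∀ v j : Fin 9, v = 0 ∨ v = 1 ∨ v = 6 → N (.inr v) (.inr j) = 0 := by
    intro v j hv
    by_cases h : v = j
    · exact h ▸ hN.diag_eq_zero hr hv
    · exact (hN _ _ (by simpa using h)).2 rfl
  have hd : ∀ i, r i ≠ c i ∧ ¬ nonAdj (r i) (c i) = true := by decide
  -- Point-point positions may hit the diagonal of `N`; `hpt` makes them zero.
  have h0 : ∀ i j, i < j → (r i ≠ c j ∧ nonAdj (r i) (c j) = true) ∨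
      ∃ v k : Fin 9, r i = .inr v ∧ c j = .inr k ∧ (v = 0 ∨ v = 1 ∨ v = 6) := by decide
  obtain ⟨α, hα⟩ := exists_row_eq_sum N r (linearIndependent_of_lowerTriangular N r c
    (fun i => (hN _ _ (hd i).1).not.2 (hd i).2) fun i j h => by
      rcases h0 i j h with h | ⟨v, k, h1, h2, hv⟩
      · exact (hN _ _ h.1).2 h.2
      · rw [h1, h2, hpt v k hv]) hr (.inl i)
  refine ⟨α 5, α 4, α 3, fun j => ?_⟩
  rw [hα, Fin.sum_univ_six]
  simp only [r, Matrix.cons_val, hpt 0 j (by simp), hpt 1 j (by simp), hpt 6 j (by simp)]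
  ring

/-! ### The golden ratio from collinearities -/

/-- Vectors annihilated by a common functional that is nonzero somewhere have determinant zero. -/
theorem det_eq_zero_of_functional {F : Type*} [Field F] {u v w : F}
    {x₁ y₁ z₁ x₂ y₂ z₂ x₃ y₃ z₃ x y z : F}
    (h₁ : u * x₁ + v * y₁ + w * z₁ = 0) (h₂ : u * x₂ + v * y₂ + w * z₂ = 0)
    (h₃ : u * x₃ + v * y₃ + w * z₃ = 0) (h : u * x + v * y + w * z ≠ 0) :
    x₁ * (y₂ * z₃ - z₂ * y₃) - y₁ * (x₂ * z₃ - z₂ * x₃) + z₁ * (x₂ * y₃ - y₂ * x₃) = 0 := by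
  set d := x₁ * (y₂ * z₃ - z₂ * y₃) - y₁ * (x₂ * z₃ - z₂ * x₃) + z₁ * (x₂ * y₃ - y₂ * x₃) with hd
  have hu : d * u = 0 := by
    rw [hd]
    linear_combination (y₂ * z₃ - z₂ * y₃) * h₁ - (y₁ * z₃ - z₁ * y₃) * h₂ +
      (y₁ * z₂ - z₁ * y₂) * h₃
  have hv : d * v = 0 := by
    rw [hd]
    linear_combination -(x₂ * z₃ - z₂ * x₃) * h₁ + (x₁ * z₃ - z₁ * x₃) * h₂ -
      (x₁ * z₂ - z₁ * x₂) * h₃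
  have hw : d * w = 0 := by
    rw [hd]
    linear_combination (x₂ * y₃ - y₂ * x₃) * h₁ - (x₁ * y₃ - y₁ * x₃) * h₂ +
      (x₁ * y₂ - y₁ * x₂) * h₃
  refine (mul_eq_zero.1 (?_ : d * (u * x + v * y + w * z) = 0)).resolve_right h
  linear_combination x * hu + y * hv + z * hw

/-- A matrix of rank at most six with the pattern of the configuration forces the golden ratio
into the field. -/
theorem HasConfigPattern.exists_golden {F : Type*} [Field F]
    {N : Matrix (Fin 9 ⊕ Fin 9) (Fin 9 ⊕ Fin 9) F} (hN : HasConfigPattern N) (hr : N.rank ≤ 6) :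
    ∃ t : F, t ^ 2 + t = 1 := by
  -- Homogeneous coordinates in which the triangle `A`, `B`, `G` is the coordinate triangle.
  obtain ⟨x, hx⟩ : ∃ x : Fin 9 → F, ∀ j, x j = N (.inl 4) (.inr j) := ⟨_, fun _ => rfl⟩
  obtain ⟨y, hy⟩ : ∃ y : Fin 9 → F, ∀ j, y j = N (.inl 1) (.inr j) := ⟨_, fun _ => rfl⟩
  obtain ⟨z, hz⟩ : ∃ z : Fin 9 → F, ∀ j, z j = N (.inl 0) (.inr j) := ⟨_, fun _ => rfl⟩
  have hpat : ∀ i j, N (.inl i) (.inr j) = 0 ↔ j ∈ configLine i := fun i j =>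
    (hN _ _ (by simp)).trans (by simp [nonAdj])
  have hx0 : ∀ j, x j = 0 ↔ j ∈ configLine 4 := fun j => hx j ▸ hpat 4 j
  have hy0 : ∀ j, y j = 0 ↔ j ∈ configLine 1 := fun j => hy j ▸ hpat 1 j
  have hz0 : ∀ j, z j = 0 ↔ j ∈ configLine 0 := fun j => hz j ▸ hpat 0 j
  have key : ∀ i j k l m : Fin 9,
      (j ∈ configLine i ∧ k ∈ configLine i ∧ l ∈ configLine i ∧ m ∉ configLine i) →
      x j * (y k * z l - z k * y l) - y j * (x k * z l - z k * x l) +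
        z j * (x k * y l - y k * x l) = 0 := by
    rintro i j k l m ⟨hj, hk, hl, hm⟩
    obtain ⟨u, v, w, h⟩ := hN.exists_coeff hr i
    have h' : ∀ j, u * x j + v * y j + w * z j = N (.inl i) (.inr j) := fun j => by
      rw [h, hx, hy, hz]
    exact det_eq_zero_of_functional ((h' j).trans ((hpat i j).2 hj))
      ((h' k).trans ((hpat i k).2 hk)) ((h' l).trans ((hpat i l).2 hl))
      (fun e => hm ((hpat i m).1 ((h' m).symm.trans e)))
  have hAHI := key 2 0 7 8 1 (by decide)
  have hBCH := key 3 1 2 7 0 (by decide)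
  have hCEG := key 5 2 4 6 0 (by decide)
  have hCFI := key 6 2 5 8 0 (by decide)
  have hDEI := key 7 3 4 8 0 (by decide)
  have hDFH := key 8 3 5 7 0 (by decide)
  have xA : x 0 ≠ 0 := (hx0 0).not.2 (by decide)
  have yA : y 0 = 0 := (hy0 0).2 (by decide)
  have zA : z 0 = 0 := (hz0 0).2 (by decide)
  have xB : x 1 = 0 := (hx0 1).2 (by decide)
  have yB : y 1 ≠ 0 := (hy0 1).not.2 (by decide)
  have zB : z 1 = 0 := (hz0 1).2 (by decide)
  have zC : z 2 ≠ 0 := (hz0 2).not.2 (by decide)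
  have xD : x 3 ≠ 0 := (hx0 3).not.2 (by decide)
  have yD : y 3 = 0 := (hy0 3).2 (by decide)
  have zD : z 3 ≠ 0 := (hz0 3).not.2 (by decide)
  have xE : x 4 ≠ 0 := (hx0 4).not.2 (by decide)
  have yE : y 4 ≠ 0 := (hy0 4).not.2 (by decide)
  have zE : z 4 = 0 := (hz0 4).2 (by decide)
  have xF : x 5 ≠ 0 := (hx0 5).not.2 (by decide)
  have zF : z 5 = 0 := (hz0 5).2 (by decide)
  have xG : x 6 = 0 := (hx0 6).2 (by decide)
  have yG : y 6 = 0 := (hy0 6).2 (by decide)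
  have zG : z 6 ≠ 0 := (hz0 6).not.2 (by decide)
  have zH : z 7 ≠ 0 := (hz0 7).not.2 (by decide)
  have xI : x 8 = 0 := (hx0 8).2 (by decide)
  have zI : z 8 ≠ 0 := (hz0 8).not.2 (by decide)
  simp only [yA, zA, xB, zB, yD, zE, zF, xG, yG, xI, zero_mul, mul_zero, sub_zero, zero_sub,
    add_zero] at hAHI hBCH hCEG hCFI hDEI hDFH
  -- Up to scaling, `C = (c, b, 1)`, `D = (d, 0, 1)`, `E = (1, e, 0)`, `F = (1, f, 0)`, `H = (g, h,
  -- 1)`, `I = (0, i, 1)`.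
  obtain ⟨c, hc⟩ : ∃ c, x 2 = c * z 2 := ⟨x 2 / z 2, by field_simp⟩
  obtain ⟨b, hb⟩ : ∃ b, y 2 = b * z 2 := ⟨y 2 / z 2, by field_simp⟩
  obtain ⟨d, hd⟩ : ∃ d, x 3 = d * z 3 := ⟨x 3 / z 3, by field_simp⟩
  obtain ⟨e, he⟩ : ∃ e, y 4 = e * x 4 := ⟨y 4 / x 4, by field_simp⟩
  obtain ⟨f, hf⟩ : ∃ f, y 5 = f * x 5 := ⟨y 5 / x 5, by field_simp⟩
  obtain ⟨g, hg⟩ : ∃ g, x 7 = g * z 7 := ⟨x 7 / z 7, by field_simp⟩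
  obtain ⟨h, hh⟩ : ∃ h, y 7 = h * z 7 := ⟨y 7 / z 7, by field_simp⟩
  obtain ⟨i, hi⟩ : ∃ i, y 8 = i * z 8 := ⟨y 8 / z 8, by field_simp⟩
  have hd0 : d ≠ 0 := by rintro rfl; simp [hd] at xD
  have he0 : e ≠ 0 := by rintro rfl; simp [he] at yE
  rw [hh, hi] at hAHI
  rw [hc, hg] at hBCH
  rw [hc, hb, he] at hCEG
  rw [hc, hb, hf, hi] at hCFI
  rw [hd, he, hi] at hDEI
  rw [hd, hf, hg, hh] at hDFH
  have e1 : h = i := by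
    apply mul_left_cancel₀ (mul_ne_zero xA (mul_ne_zero zH zI)); linear_combination hAHI
  have e2 : g = c := by
    apply mul_left_cancel₀ (mul_ne_zero yB (mul_ne_zero zC zH)); linear_combination hBCH
  have e3 : b = c * e := by
    apply mul_left_cancel₀ (mul_ne_zero zC (mul_ne_zero xE zG)); linear_combination -hCEG
  have e4 : c * f - b + i = 0 := by
    apply mul_left_cancel₀ (mul_ne_zero zC (mul_ne_zero xF zI)); linear_combination hCFI
  have e5 : d * e + i = 0 := by
    apply mul_left_cancel₀ (mul_ne_zero zD (mul_ne_zero xE zI)); linear_combination hDEI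
  have e6 : d * f + h - g * f = 0 := by
    apply mul_left_cancel₀ (mul_ne_zero zD (mul_ne_zero xF zH)); linear_combination hDFH
  -- Eliminating `i` and `f` leaves `c ^ 2 + c * d = d ^ 2`.
  refine ⟨c / d, ?_⟩
  subst e1 e2 e3
  field_simp
  apply mul_left_cancel₀ he0
  have hf' : d * f = (g + 2 * d) * e := by linear_combination e6 + e4 - 2 * e5
  linear_combination d * (e4 - e5) - g * hf'

theorem rat_not_golden (t : ℚ) : t ^ 2 + t ≠ 1 := by
  intro h
  have h5 : ((2 * t + 1 : ℚ)) ^ 2 = 5 := by linear_combination 4 * h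
  have hsq : IsSquare ((5 : ℕ) : ℚ) := ⟨2 * t + 1, by push_cast; linear_combination -h5⟩
  rw [Rat.isSquare_natCast_iff] at hsq
  obtain ⟨n, hn⟩ := hsq
  have : n < 3 := by nlinarith
  interval_cases n <;> omega

theorem HasConfigPattern.six_lt_rank_of_rat {N : Matrix (Fin 9 ⊕ Fin 9) (Fin 9 ⊕ Fin 9) ℚ}
    (hN : HasConfigPattern N) : 6 < N.rank := by
  by_contra h
  obtain ⟨t, ht⟩ := hN.exists_golden (not_lt.1 h)
  exact rat_not_golden t ht

/-! ### A real realization -/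

theorem exists_realizes : ∃ x y a b c : Fin 9 → ℝ, Realizes x y a b c := by
  obtain ⟨s, hs, h1, h2⟩ : ∃ s : ℝ, s ^ 2 = 1 - s ∧ 3 / 5 < s ∧ s < 2 / 3 := by
    have h := Real.sq_sqrt (show (0 : ℝ) ≤ 5 by norm_num)
    refine ⟨(√5 - 1) / 2, by linear_combination h / 4, ?_, ?_⟩
    · have : (11 / 5 : ℝ) < √5 := Real.lt_sqrt_of_sq_lt (by norm_num)
      linarith
    · have : √5 < 7 / 3 := (Real.sqrt_lt' (by norm_num)).2 (by norm_num)
      linarith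
  -- The coordinates of `HasConfigPattern.exists_golden` with `d = e = 1` and `c = s`.
  let px : Fin 9 → ℝ := ![1, 0, s, 1, 1, 1, 0, s, 0]
  let py : Fin 9 → ℝ := ![0, 1, s, 0, 1, s + 2, 0, -1, -1]
  let pz : Fin 9 → ℝ := ![0, 0, 1, 1, 0, 0, 1, 1, 1]
  let u : Fin 9 → ℝ := ![0, 0, 0, 1, 1, 1, -(s + 2), -1, -(s + 2)]
  let v : Fin 9 → ℝ := ![0, 1, 1, 0, 0, -1, 1, 1, 1]
  let w : Fin 9 → ℝ := ![1, 0, 1, -s, 0, 0, 1, 1, s + 2]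
  -- The line `X + 2Y + 4Z = 0` misses all nine points, so it can be sent to infinity. Substituting
  -- `Z = (1 - X - 2Y) / 4` gives the affine line coefficients below.
  have hφ : ∀ j, px j + 2 * py j + 4 * pz j ≠ 0 := by
    intro j
    apply ne_of_gt
    fin_cases j <;> simp [px, py, pz] <;> linarith
  have hinc : ∀ i j, u i * px j + v i * py j + w i * pz j = 0 ↔ j ∈ configLine i := by
    intro i j
    fin_cases i <;> fin_cases j <;> simp [px, py, pz, u, v, w, configLine] <;>
      first
      | linear_combination -hs
      | (intro h; nlinarith)
      | (constructor <;> intro h <;> linarith)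
  refine ⟨fun j => px j / (px j + 2 * py j + 4 * pz j), fun j => py j / (px j + 2 * py j + 4 * pz j),
    fun i => u i - w i / 4, fun i => v i - w i / 2, fun i => w i / 4, fun i => ?_, fun i j => ?_⟩
  · fin_cases i <;> simp [u, v, w] <;>
      (left; intro h; linarith)
  · rw [← hinc]
    have h := hφ j
    have : (u i - w i / 4) * (px j / (px j + 2 * py j + 4 * pz j)) +
        (v i - w i / 2) * (py j / (px j + 2 * py j + 4 * pz j)) + w i / 4 =
        (u i * px j + v i * py j + w i * pz j) / (px j + 2 * py j + 4 * pz j) := by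
      field_simp
      ring
    rw [this, div_eq_zero_iff, or_iff_left h]

/-! ### Ranks and patterns for a given realization -/

section Realization

variable {x y a b c : Fin 9 → ℝ}

theorem matB_eq_mul (x y a b c : Fin 9 → ℝ) : matB x y a b c =
    Matrix.fromRows 1 (lineMatrix a b c) * Matrix.fromCols 1 (pointMatrix x y) := by
  rw [Matrix.fromRows_mul_fromCols]
  simp [matB]

theorem rank_matB (x y a b c : Fin 9 → ℝ) : (matB x y a b c).rank = 3 := by
  apply le_antisymm
  · rw [matB_eq_mul]
    exact (Matrix.rank_mul_le_left _ _).trans ((Matrix.rank_le_card_width _).trans (by simp))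
  · have h := Matrix.rank_submatrix_le (matB x y a b c) Sum.inl Sum.inl
    have h1 : (matB x y a b c).submatrix Sum.inl Sum.inl = 1 := by
      ext i j; simp [matB]
    rw [h1, Matrix.rank_one] at h
    simpa using h

theorem rank_matA_le (x y a b c : Fin 9 → ℝ) : (matA x y a b c).rank ≤ 6 := by
  have h : matA x y a b c =
      Matrix.fromBlocks (Matrix.fromRows 1 (lineMatrix a b c)) 0 0
        (Matrix.fromCols 1 (pointMatrix x y)).transpose *
      Matrix.fromBlocks 0 (Matrix.fromCols 1 (pointMatrix x y))
        (Matrix.fromRows 1 (lineMatrix a b c)).transpose 0 := by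
    rw [Matrix.fromBlocks_multiply]
    rw [← Matrix.transpose_mul, ← matB_eq_mul]
    simp [matA]
  rw [h]
  exact (Matrix.rank_mul_le_left _ _).trans ((Matrix.rank_le_card_width _).trans (by simp))

theorem isSymm_matA (x y a b c : Fin 9 → ℝ) : (matA x y a b c).IsSymm :=
  Matrix.IsSymm.fromBlocks (by simp) (by simp) (by simp)

theorem configGraph_isBipartiteWith (x y a b c : Fin 9 → ℝ) :
    (configGraph x y a b c).IsBipartiteWith (Set.range Sum.inl) (Set.range Sum.inr) where
  disjoint := Set.isCompl_range_inl_range_inr.disjoint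
  mem_of_adj := by
    rintro (p | p) (q | q) h <;> simp [configGraph, matA] at h ⊢

theorem Realizes.matB_eq_zero_iff (h : Realizes x y a b c) (i j : Fin 9) :
    matB x y a b c (.inr i) (.inr j) = 0 ↔ j ∈ configLine i := by
  rw [← h.2 i j]
  simp [matB, lineMatrix, pointMatrix, Matrix.mul_apply, Fin.sum_univ_three]

/-- Restricting a matrix with the off-diagonal pattern of the graph to the lines and points. -/
theorem Realizes.hasConfigPattern (h : Realizes x y a b c) {F : Type*} [Field F]
    {M : Matrix ((Fin 3 ⊕ Fin 9) ⊕ (Fin 3 ⊕ Fin 9)) ((Fin 3 ⊕ Fin 9) ⊕ (Fin 3 ⊕ Fin 9)) F}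
    (hM : ∀ p q, p ≠ q → (M p q ≠ 0 ↔ (configGraph x y a b c).Adj p q)) :
    HasConfigPattern (M.submatrix (Sum.map .inr .inr) (Sum.map .inr .inr)) := by
  have hM' : ∀ p q, p ≠ q → (M p q = 0 ↔ matA x y a b c p q = 0) := fun p q hpq =>
    not_iff_not.1 (hM p q hpq)
  intro p q hpq
  rw [Matrix.submatrix_apply, hM' _ _ (((Sum.inr_injective).sumMap Sum.inr_injective).ne hpq)]
  rcases p with i | i <;> rcases q with j | j <;>
    simp [matA, nonAdj, h.matB_eq_zero_iff]

theorem Realizes.six_le_rank (h : Realizes x y a b c) {F : Type*} [Field F]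
    {M : Matrix ((Fin 3 ⊕ Fin 9) ⊕ (Fin 3 ⊕ Fin 9)) ((Fin 3 ⊕ Fin 9) ⊕ (Fin 3 ⊕ Fin 9)) F}
    (hM : ∀ p q, p ≠ q → (M p q ≠ 0 ↔ (configGraph x y a b c).Adj p q)) : 6 ≤ M.rank :=
  (h.hasConfigPattern hM).six_le_rank.trans (Matrix.rank_submatrix_le _ _ _)

theorem Realizes.six_lt_rank (h : Realizes x y a b c)
    {M : Matrix ((Fin 3 ⊕ Fin 9) ⊕ (Fin 3 ⊕ Fin 9)) ((Fin 3 ⊕ Fin 9) ⊕ (Fin 3 ⊕ Fin 9)) ℚ}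
    (hM : ∀ p q, p ≠ q → (M p q ≠ 0 ↔ (configGraph x y a b c).Adj p q)) : 6 < M.rank :=
  (h.hasConfigPattern hM).six_lt_rank_of_rat.trans_le (Matrix.rank_submatrix_le _ _ _)

end Realization

theorem mainTheorem2 :
    (∃ x y a b c : Fin 9 → ℝ, Realizes x y a b c) ∧
    ∀ x y a b c : Fin 9 → ℝ, Realizes x y a b c →
      (matB x y a b c).rank = 3 ∧
      (matA x y a b c).IsSymm ∧
      (matA x y a b c).rank = 6 ∧
      (configGraph x y a b c).IsBipartiteWith (Set.range Sum.inl) (Set.range Sum.inr) ∧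
      graphMinRank ℝ (configGraph x y a b c) = 6 ∧
      graphMinRank ℝ (configGraph x y a b c) < graphMinRank ℚ (configGraph x y a b c) ∧
      adjPatternMinRank ℝ (configGraph x y a b c) = 6 ∧
      adjPatternMinRank ℝ (configGraph x y a b c) <
        adjPatternMinRank ℚ (configGraph x y a b c) := by
  classical
  refine ⟨exists_realizes, fun x y a b c h => ?_⟩
  have hA : (matA x y a b c).rank = 6 :=
    le_antisymm (rank_matA_le x y a b c) (h.six_le_rank fun _ _ _ => Iff.rfl)
  have hmin : ∀ S : Set (Matrix ((Fin 3 ⊕ Fin 9) ⊕ (Fin 3 ⊕ Fin 9))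
      ((Fin 3 ⊕ Fin 9) ⊕ (Fin 3 ⊕ Fin 9)) ℝ), matA x y a b c ∈ S →
      (∀ M ∈ S, ∀ p q, p ≠ q → (M p q ≠ 0 ↔ (configGraph x y a b c).Adj p q)) →
      sInf (Matrix.rank '' S) = 6 := by
    intro S hS hp
    apply le_antisymm ((Nat.sInf_le (Set.mem_image_of_mem Matrix.rank hS)).trans hA.le)
    obtain ⟨M, hM, hr⟩ := Nat.sInf_mem (Set.Nonempty.image Matrix.rank ⟨_, hS⟩)
    exact hr ▸ h.six_le_rank (hp M hM)
  -- A member of `S` is needed: in ℕ the infimum of the empty set is 0.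
  have hgt : ∀ S : Set (Matrix ((Fin 3 ⊕ Fin 9) ⊕ (Fin 3 ⊕ Fin 9))
      ((Fin 3 ⊕ Fin 9) ⊕ (Fin 3 ⊕ Fin 9)) ℚ), (configGraph x y a b c).adjMatrix ℚ ∈ S →
      (∀ M ∈ S, ∀ p q, p ≠ q → (M p q ≠ 0 ↔ (configGraph x y a b c).Adj p q)) →
      6 < sInf (Matrix.rank '' S) := by
    intro S hS hp
    obtain ⟨M, hM, hr⟩ := Nat.sInf_mem (Set.Nonempty.image Matrix.rank ⟨_, hS⟩)
    exact hr ▸ h.six_lt_rank (hp M hM)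
  have h1 : graphMinRank ℝ (configGraph x y a b c) = 6 :=
    hmin _ ⟨isSymm_matA x y a b c, fun _ _ _ => Iff.rfl⟩ fun M hM => hM.2
  have h2 : adjPatternMinRank ℝ (configGraph x y a b c) = 6 :=
    hmin _ (fun _ _ => Iff.rfl) fun M hM p q _ => hM p q
  have hQ := adjMatrix_mem_classes ℚ (configGraph x y a b c)
  refine ⟨rank_matB x y a b c, isSymm_matA x y a b c, hA, configGraph_isBipartiteWith x y a b c,
    h1, ?_, h2, ?_⟩
  · rw [h1]
    exact hgt _ hQ.1 fun M hM => hM.2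
  · rw [h2]
    exact hgt _ hQ.2 fun M hM p q _ => hM p q
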